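/- Let $Z^+=(P,Q)$ be a planar vector field, analytic in a neighbourhood of the origin, of the form \[ P(x,y)=a_{10}x+a_{01}y+P_2(x,y),\qquad Q(x,y)=b_{10}x+b_{01}y+Q_2(x,y), \] where $P_2,Q_2$ vanish at the origin together with their first derivatives and $(a_{10}-b_{01})^2+4a_{01}b_{10}<0$ (the origin is an elementary monodromic equilibrium, i.e. an elementary center or focus). Let $\Sigma=\{y=0\}$. Then there is $x_0>0$ such that, for every $x\in(0,x_0)$, there is exactly one time $\tau^+(x)\neq 0$ (possibly negative) such that the solution of $Z^+$ with initial condition $(x,0)$ is in $\Sigma$ at time $\tau^+(x)$ and in $\{y>0\}$ at all times strictly between $0$ and $\tau^+(x)$; denote by $(\varphi^+(x),0)$ its position at time $\tau^+(x)$. We have $\varphi^+(x)<0$, and the half-return map $\varphi^+$ (with $\varphi^+(0)=0$) and the flight time $\tau^+$ are analytic and extend analytically to $(-x_0,x_0)$, where they are given by the convergent power series \[ \varphi^+(x)=-\alpha_1x-\sum_{i\ge 2}\alpha_ix^i,\qquad \tau^+(x)=\hat T_0+\sum_{i\ge 1}\hat T_ix^i, \] with \[ \alpha_1=\exp\left(\operatorname{sign}(b_{10})\,\frac{\pi(a_{10}+b_{01})}{\sqrt{-4b_{10}a_{01}-(a_{10}-b_{01})^2}}\right),\qquad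 b_{10}\hat T_0>0. \] In particular, if $b_{10}>0$, then $\alpha_1=\exp\left(\pi(a_{10}+b_{01})/\sqrt{-4b_{10}a_{01}-(a_{10}-b_{01})^2}\right)$. -/

import Mathlib

open Set

/-- The planar vector field `(P, Q)`. -/
def planarField (P Q : ℝ × ℝ → ℝ) : ℝ × ℝ → ℝ × ℝ := fun z => (P z, Q z)

/-- The origin is an elementary monodromic equilibrium (elementary center/focus) of the field
`(P, Q)`, which is analytic at the origin:
`P(x,y) = a₁₀ x + a₀₁ y + P₂(x,y)` and `Q(x,y) = b₁₀ x + b₀₁ y + Q₂(x,y)`, where the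
1-jets of the analytic functions `P₂`, `Q₂` vanish at the origin, and
`(a₁₀ - b₀₁)² + 4 a₀₁ b₁₀ < 0`. -/
structure IsElementaryMonodromic (P Q : ℝ × ℝ → ℝ) (a₁₀ a₀₁ b₁₀ b₀₁ : ℝ) : Prop where
  exists_P : ∃ P₂ : ℝ × ℝ → ℝ, AnalyticAt ℝ P₂ (0, 0) ∧ P₂ (0, 0) = 0 ∧
    HasFDerivAt P₂ (0 : ℝ × ℝ →L[ℝ] ℝ) (0, 0) ∧
    ∀ x y : ℝ, P (x, y) = a₁₀ * x + a₀₁ * y + P₂ (x, y)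
  exists_Q : ∃ Q₂ : ℝ × ℝ → ℝ, AnalyticAt ℝ Q₂ (0, 0) ∧ Q₂ (0, 0) = 0 ∧
    HasFDerivAt Q₂ (0 : ℝ × ℝ →L[ℝ] ℝ) (0, 0) ∧
    ∀ x y : ℝ, Q (x, y) = b₁₀ * x + b₀₁ * y + Q₂ (x, y)
  disc_neg : (a₁₀ - b₀₁) ^ 2 + 4 * a₀₁ * b₁₀ < 0

/-- The orbit of `Z` starting at `(x, 0)` at time `0` reaches the line `y = 0` at the nonzero
(possibly negative) time `t`, at the point `(ξ, 0)`, and stays in the open upper half-plane at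
all times strictly between `0` and `t`. -/
def UpperArc (Z : ℝ × ℝ → ℝ × ℝ) (x t ξ : ℝ) : Prop :=
  t ≠ 0 ∧ ∃ γ : ℝ → ℝ × ℝ,
    γ 0 = (x, 0) ∧ γ t = (ξ, 0) ∧
    (∀ s ∈ uIcc 0 t, HasDerivWithinAt γ (Z (γ s)) (uIcc 0 t) s) ∧
    ∀ s ∈ Ioo (min 0 t) (max 0 t), 0 < (γ s).2

/-- `φ` (on `[0, x₀)`) is the half-return map and `τ` (on `(0, x₀)`) is the flight time of the
field `Z` on the upper half-plane: for `0 < x < x₀`, the pair `(τ x, φ x)` is the one and only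
pair (time, abscissa) of an upper orbit arc from `(x, 0)` to the line `y = 0`. -/
structure IsHalfReturn (Z : ℝ × ℝ → ℝ × ℝ) (x₀ : ℝ) (φ τ : ℝ → ℝ) : Prop where
  pos : 0 < x₀
  arc_iff : ∀ x ∈ Ioo 0 x₀, ∀ t ξ : ℝ, UpperArc Z x t ξ ↔ t = τ x ∧ ξ = φ x
  map_neg : ∀ x ∈ Ioo 0 x₀, φ x < 0
  map_zero : φ 0 = 0
  continuousOn_map : ContinuousOn φ (Ico 0 x₀)
  continuousOn_time : ContinuousOn τ (Ioo 0 x₀)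

/-! The origin is an equilibrium, so the return is studied after the blow-up `γ (τ s) = x • u s`.
Writing `F z = M z z` with `M` analytic, the arc satisfies `u' = τ M(x u) u`, `u 0 = (1, 0)`, `(u
1).2 = 0`. This problem is regular at `x = 0`, where it is linear and solved by an explicit
half-turn of the linear flow.

Its integral form is the zero set of an analytic map of `x`, the arc in `C([0,1], E)` and the flight
time `τ`. The partial derivative in (arc, time) is bijective: the Volterra part is invertible, and
transversality at the end point fixes the time (`bijective_linearized_arc`). The analytic implicit
function theorem then gives `u` and `τ` analytic in `x` across `0` (`exists_analytic_arc`), and `φ x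
= x * (u x 1).1`.

It remains to see that, for small `x > 0`, this arc lies in the upper half-plane
(`pos_of_forall_pos_or_deriv_ne_zero`) and is the only one (`upperArc_iff`). The values at `x = 0`
are read off the linear flow. -/

open Filter Topology

/-! ### Factorization of an analytic map vanishing at the origin -/

/-- An analytic map vanishing at the origin factors as `z ↦ M z z` with `M` operator-valued and
analytic. -/
theorem AnalyticAt.exists_eventually_eq_clm_apply {E F : Type*}
    [NormedAddCommGroup E] [NormedSpace ℝ E] [NormedAddCommGroup F] [NormedSpace ℝ F]
    [CompleteSpace F] {f : E → F} {A : E →L[ℝ] F}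
    (hf : AnalyticAt ℝ f 0) (h0 : f 0 = 0) (hA : HasFDerivAt f A 0) :
    ∃ M : E → E →L[ℝ] F, AnalyticAt ℝ M 0 ∧ M 0 = A ∧ ∀ᶠ z in 𝓝 0, f z = M z z := by
  obtain ⟨p, r, hp⟩ := hf
  have hrad : 0 < p.shift.radius := by
    rw [FormalMultilinearSeries.radius_shift]
    exact hp.r_pos.trans_le hp.r_le
  have hM := p.shift.hasFPowerSeriesOnBall hrad
  have heq : ∀ᶠ z in 𝓝 (0 : E), f z = p.shift.sum z z := by
    filter_upwards [Metric.eball_mem_nhds (0 : E) hp.r_pos] with z hz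
    have h1 := hp.hasSum hz
    rw [zero_add] at h1
    -- Shifting strips one variable off each term of `p`; unshifting with constant term `0 = f 0`
    -- restores the series.
    have h2 := (hM.unshift (z := (0 : F))).hasSum (y := z)
      (Metric.eball_subset_eball (by
        rw [FormalMultilinearSeries.radius_shift]; exact hp.r_le) hz)
    simp only [zero_add, sub_zero] at h2
    refine h1.unique (h2.congr_fun ?_)
    intro n
    cases n with
    | zero =>
      have := hp.coeff_zero (fun i => z)
      simp [FormalMultilinearSeries.unshift, this, h0]
    | succ n =>
      simp [FormalMultilinearSeries.unshift, FormalMultilinearSeries.shift]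
  refine ⟨p.shift.sum, hM.analyticAt, ?_, heq⟩
  -- In the product rule at `0`, the term with the derivative of `M` is evaluated at the vector `0`,
  -- so only `M 0` survives.
  have hd := hM.analyticAt.differentiableAt.hasFDerivAt.clm_apply (hasFDerivAt_id (0 : E))
  have hd' := hd.congr_of_eventuallyEq (f₁ := f) heq
  have := hd'.unique hA
  rw [← this]
  ext v
  simp

/-! ### Superposition operators on spaces of continuous functions -/

section ContinuousFunctionSpaces

variable {K : Type*} [TopologicalSpace K] [CompactSpace K]
  {E G : Type*} [NormedAddCommGroup E] [NormedSpace ℝ E] [NormedAddCommGroup G] [NormedSpace ℝ G]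

/-- A continuous multilinear map acts pointwise on continuous functions. -/
noncomputable def ContinuousMultilinearMap.pointwise (K : Type*) [TopologicalSpace K]
    [CompactSpace K] {n : ℕ} (m : ContinuousMultilinearMap ℝ (fun _ : Fin n => E) G) :
    ContinuousMultilinearMap ℝ (fun _ : Fin n => C(K, E)) C(K, G) :=
  MultilinearMap.mkContinuous
    { toFun := fun u => ⟨fun t => m fun i => u i t, by fun_prop⟩
      map_update_add' := by
        intro inst u i v w
        obtain rfl : inst = instDecidableEqFin n := Subsingleton.elim _ _
        ext t
        simp [Function.apply_update (fun _ (w : C(K, E)) => w t)]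
      map_update_smul' := by
        intro inst u i c v
        obtain rfl : inst = instDecidableEqFin n := Subsingleton.elim _ _
        ext t
        simp [Function.apply_update (fun _ (w : C(K, E)) => w t)] }
    ‖m‖ (by
      intro u
      rw [ContinuousMap.norm_le _ (by positivity)]
      intro t
      refine (m.le_opNorm _).trans ?_
      gcongr with i
      exact (u i).norm_coe_le_norm t)

theorem ContinuousMultilinearMap.norm_pointwise_le {n : ℕ}
    (m : ContinuousMultilinearMap ℝ (fun _ : Fin n => E) G) : ‖m.pointwise K‖ ≤ ‖m‖ :=
  MultilinearMap.mkContinuous_norm_le _ (norm_nonneg _) _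

/-- The superposition operator of a map analytic at the origin is analytic at the zero function. -/
theorem AnalyticAt.exists_superposition (K : Type*) [TopologicalSpace K] [CompactSpace K]
    [CompleteSpace G] {M : E → G} (hM : AnalyticAt ℝ M 0) :
    ∃ N : C(K, E) → C(K, G), AnalyticAt ℝ N 0 ∧ ∀ᶠ u in 𝓝 0, ∀ t, N u t = M (u t) := by
  obtain ⟨p, r, hp⟩ := hM
  -- Coefficients acting pointwise have no larger norms, so `q` converges at least where `p` does.
  let q : FormalMultilinearSeries ℝ C(K, E) C(K, G) := fun n => (p n).pointwise K
  have hpq : p.radius ≤ q.radius := by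
    refine ENNReal.le_of_forall_nnreal_lt fun s hs => ?_
    obtain ⟨C, -, hC⟩ := p.norm_mul_pow_le_of_lt_radius hs
    refine q.le_radius_of_bound C fun n => (mul_le_mul_of_nonneg_right
      (p n).norm_pointwise_le (by positivity)).trans (hC n)
  have hq0 : 0 < q.radius := (hp.r_pos.trans_le hp.r_le).trans_le hpq
  have hq := q.hasFPowerSeriesOnBall hq0
  refine ⟨q.sum, hq.analyticAt, ?_⟩
  filter_upwards [Metric.eball_mem_nhds (0 : C(K, E)) hp.r_pos] with u hu t
  have h1 := hq.hasSum (Metric.eball_subset_eball (hp.r_le.trans hpq) hu)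
  have h2 := hp.hasSum (y := u t) (by
    rw [Metric.mem_eball, edist_zero_right] at hu ⊢
    refine lt_of_le_of_lt ?_ hu
    rw [enorm_le_iff_norm_le]
    exact u.norm_coe_le_norm t)
  rw [zero_add] at h1 h2
  exact ((ContinuousMap.evalCLM ℝ t).hasSum h1).unique h2

/-- Pointwise application of operator-valued continuous functions. -/
noncomputable def ContinuousMap.applyCLM (K E G : Type*) [TopologicalSpace K] [CompactSpace K]
    [NormedAddCommGroup E] [NormedSpace ℝ E] [NormedAddCommGroup G] [NormedSpace ℝ G] :
    C(K, E →L[ℝ] G) →L[ℝ] C(K, E) →L[ℝ] C(K, G) :=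
  LinearMap.mkContinuous₂
    (LinearMap.mk₂ ℝ (fun (m : C(K, E →L[ℝ] G)) (u : C(K, E)) =>
        (⟨fun t => m t (u t), by fun_prop⟩ : C(K, G)))
      (fun _ _ _ => by ext; simp) (fun _ _ _ => by ext; simp)
      (fun _ _ _ => by ext; simp) (fun _ _ _ => by ext; simp))
    1 (by
      intro m u
      rw [one_mul, ContinuousMap.norm_le _ (by positivity)]
      intro t
      refine ((m t).le_opNorm _).trans ?_
      gcongr
      exacts [m.norm_coe_le_norm t, u.norm_coe_le_norm t])

@[simp]
theorem ContinuousMap.applyCLM_apply (m : C(K, E →L[ℝ] G)) (u : C(K, E)) (t : K) :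
    ContinuousMap.applyCLM K E G m u t = m t (u t) := rfl

end ContinuousFunctionSpaces

/-! ### The linear Volterra equation on the unit interval -/

section Primitive

open unitInterval

variable {E : Type*} [NormedAddCommGroup E]

/-- Extension of a function on `[0, 1]` to the line, constant outside of `[0, 1]`. -/
noncomputable def ContinuousMap.extendUnit (u : C(I, E)) (s : ℝ) : E :=
  u (projIcc 0 1 zero_le_one s)

theorem ContinuousMap.continuous_extendUnit (u : C(I, E)) : Continuous u.extendUnit :=
  u.continuous.comp continuous_projIcc

theorem ContinuousMap.extendUnit_coe (u : C(I, E)) (s : I) : u.extendUnit s = u s := by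
  simp [ContinuousMap.extendUnit]

theorem ContinuousMap.norm_extendUnit_le (u : C(I, E)) (s : ℝ) : ‖u.extendUnit s‖ ≤ ‖u‖ :=
  u.norm_coe_le_norm _

variable [NormedSpace ℝ E]

variable (E) in
/-- The operator sending a function on `[0, 1]` to its primitive vanishing at `0`. -/
noncomputable def primitiveCLM : C(I, E) →L[ℝ] C(I, E) :=
  LinearMap.mkContinuous
    { toFun := fun u => ⟨fun s => ∫ r in (0 : ℝ)..s, u.extendUnit r,
        (intervalIntegral.continuous_primitive
          (fun a b => u.continuous_extendUnit.intervalIntegrable a b) 0).comp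
          continuous_subtype_val⟩
      map_add' := by
        intro u v
        ext s
        exact intervalIntegral.integral_add (u.continuous_extendUnit.intervalIntegrable _ _)
          (v.continuous_extendUnit.intervalIntegrable _ _)
      map_smul' := by
        intro c u
        ext s
        exact intervalIntegral.integral_smul c _ }
    1 (by
      intro u
      rw [one_mul, ContinuousMap.norm_le _ (norm_nonneg _)]
      intro s
      refine (intervalIntegral.norm_integral_le_of_norm_le_const
        (fun r _ => u.norm_extendUnit_le r)).trans ?_
      rw [sub_zero, abs_of_nonneg s.2.1]
      exact mul_le_of_le_one_right (norm_nonneg _) s.2.2)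

theorem primitiveCLM_apply (u : C(I, E)) (s : I) :
    primitiveCLM E u s = ∫ r in (0 : ℝ)..s, u.extendUnit r := rfl

theorem ContinuousMap.hasDerivAt_integral_extendUnit [CompleteSpace E] (u : C(I, E)) (s : ℝ) :
    HasDerivAt (fun t => ∫ r in (0 : ℝ)..t, u.extendUnit r) (u.extendUnit s) s :=
  intervalIntegral.integral_hasDerivAt_right (u.continuous_extendUnit.intervalIntegrable _ _)
    (u.continuous_extendUnit.stronglyMeasurableAtFilter _ _) u.continuous_extendUnit.continuousAt

/-- A primitive is determined by its derivative and its value at `0`. -/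
theorem primitiveCLM_apply_eq_sub [CompleteSpace E] {y : ℝ → E} (u : C(I, E))
    (hy : ∀ s : I, HasDerivAt y (u s) s) (s : I) : primitiveCLM E u s = y s - y 0 := by
  rw [primitiveCLM_apply]
  refine intervalIntegral.integral_eq_sub_of_hasDerivAt (fun r hr => ?_)
    (u.continuous_extendUnit.intervalIntegrable _ _)
  rw [uIcc_of_le s.2.1] at hr
  have := hy ⟨r, hr.1, hr.2.trans s.2.2⟩
  rwa [← u.extendUnit_coe] at this

/-- Such a `v` solves `v' = B v` with `v 0 = 0`, so uniqueness for this Lipschitz equation applies.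
-/
theorem primitiveCLM_clm_injective [CompleteSpace E] (B : E →L[ℝ] E) {v : C(I, E)}
    (hv : v = primitiveCLM E (ContinuousMap.applyCLM I E E (.const I B) v)) : v = 0 := by
  let V : ℝ → E := fun s =>
    ∫ r in (0 : ℝ)..s, (ContinuousMap.applyCLM I E E (.const I B) v).extendUnit r
  have hV : ∀ s : I, V s = v s := fun s => by
    conv_rhs => rw [hv]
    rfl
  have hd : ∀ s ∈ Icc (0 : ℝ) 1, HasDerivAt V (B (V s)) s := by
    intro s hs
    have := (ContinuousMap.applyCLM I E E (.const I B) v).hasDerivAt_integral_extendUnit s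
    have h2 := (ContinuousMap.applyCLM I E E (.const I B) v).extendUnit_coe ⟨s, hs⟩
    rw [h2, ContinuousMap.applyCLM_apply, ContinuousMap.const_apply, ← hV] at this
    exact this
  have := ODE_solution_unique (v := fun _ => B) (f := V) (g := fun _ => 0) (a := 0) (b := 1)
    (fun _ => B.lipschitz)
    (fun s hs => (hd s hs).continuousAt.continuousWithinAt)
    (fun s hs => (hd s (Ico_subset_Icc_self hs)).hasDerivWithinAt)
    continuousOn_const
    (fun s _ => by simpa using hasDerivWithinAt_const s (Ici s) (0 : E))
    (by simp [V])
  ext s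
  rw [← hV]
  exact this s.2

/-- Variation of constants: with `v = w + Y` the equation becomes `Y' = B (w + Y)`, `Y 0 = 0`,
solved by the integral of `exp ((s - r) B) (B (w r))` over `r` from `0` to `s`. -/
theorem primitiveCLM_clm_surjective [CompleteSpace E] (B : E →L[ℝ] E) (w : C(I, E)) :
    ∃ v, v - primitiveCLM E (ContinuousMap.applyCLM I E E (.const I B) v) = w := by
  have hexp (s : ℝ) := hasDerivAt_exp_smul_const' B s
  have hexpn : Continuous fun s : ℝ => NormedSpace.exp ((-s) • B) := by
    rw [continuous_iff_continuousAt]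
    intro s
    exact (ContinuousAt.comp (g := fun s : ℝ => NormedSpace.exp (s • B))
      (hexp (-s)).continuousAt continuousAt_neg)
  let g : C(I, E) := ⟨fun s => NormedSpace.exp ((-(s : ℝ)) • B) (B (w s)), by
    exact (hexpn.comp continuous_subtype_val).clm_apply (by fun_prop)⟩
  let y : ℝ → E := fun s => NormedSpace.exp (s • B) (∫ r in (0 : ℝ)..s, g.extendUnit r)
  have hy : ∀ s : I, HasDerivAt y (B (w s + y s)) s := by
    intro s
    have h := (hexp s).clm_apply (g.hasDerivAt_integral_extendUnit s)
    have h2 : NormedSpace.exp ((s : ℝ) • B) (g s) = B (w s) := by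
      change (NormedSpace.exp ((s : ℝ) • B) * NormedSpace.exp ((-(s : ℝ)) • B)) (B (w s)) = _
      let _ : NormedAlgebra ℚ (E →L[ℝ] E) := NormedAlgebra.restrictScalars ℚ ℝ _
      rw [← NormedSpace.exp_add_of_commute (by
        exact ((Commute.refl B).smul_left _).smul_right _), ← add_smul]
      simp
    rw [g.extendUnit_coe, h2] at h
    convert h using 1
    rw [map_add, add_comm]
    rfl
  let Y : C(I, E) := ⟨fun s => y s, by
    rw [continuous_iff_continuousAt]
    intro s
    exact ContinuousAt.comp (g := y) (hy s).continuousAt continuousAt_subtype_val⟩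
  refine ⟨w + Y, ?_⟩
  ext s
  have := primitiveCLM_apply_eq_sub (ContinuousMap.applyCLM I E E (.const I B) (w + Y)) hy s
  rw [ContinuousMap.sub_apply, this]
  simp [Y, y]

end Primitive

/-! ### The rescaled boundary value problem and the implicit function theorem -/

section Arc

open unitInterval

variable {E : Type*} [NormedAddCommGroup E] [NormedSpace ℝ E] [CompleteSpace E]

/-- The linearization, in the unknown arc and the unknown flight time, of the boundary value problem
`u' = τ A u`, `u 0 = e`, `ℓ (u 1) = 0` is bijective if the unperturbed arc is transverse to the
kernel of `ℓ` at its end. -/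
theorem bijective_linearized_arc {A : E →L[ℝ] E} {ℓ : E →L[ℝ] ℝ} {T : ℝ} {y : ℝ → E} {u : C(I, E)}
    (hu : ∀ s : I, u s = y s) (hy : ∀ s, HasDerivAt y (T • A (y s)) s) (hℓ : ℓ (A (u 1)) ≠ 0)
    {L : C(I, E) →L[ℝ] C(I, E)}
    (hL : ∀ v, L v = primitiveCLM E (ContinuousMap.applyCLM I E E (.const I A) v)) :
    Function.Bijective fun p : C(I, E) × ℝ => (p.1 - T • L p.1 - p.2 • L u, ℓ (p.1 1)) := by
  have hTL (v : C(I, E)) : T • L v =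
      primitiveCLM E (ContinuousMap.applyCLM I E E (.const I (T • A)) v) := by
    rw [hL, ← map_smul]
    rfl
  have hyc : Continuous y := continuous_iff_continuousAt.2 fun s => (hy s).continuousAt
  -- `z` is the derivative of the linear arc with respect to the flight time `T`. It solves `z' = A
  -- y + T A z`.
  let z : C(I, E) := ⟨fun s => (s : ℝ) • A (y s), by fun_prop⟩
  have hz : z - T • L z = L u := by
    have hd (s : I) : HasDerivAt (fun s : ℝ => s • A (y s))
        ((ContinuousMap.applyCLM I E E (.const I A) (u + T • z)) s) s := by
      have h1 := (hasDerivAt_id (s : ℝ)).smul (A.hasFDerivAt.comp_hasDerivAt (s : ℝ) (hy s))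
      refine HasDerivAt.congr_deriv (f := fun s : ℝ => s • A (y s)) h1 ?_
      simp [z, hu, add_comm, smul_comm T]
    have h := primitiveCLM_apply_eq_sub _ hd
    have h2 : L (u + T • z) = z := by
      ext s
      rw [hL, h]
      simp [z]
    rw [map_add, map_smul] at h2
    rw [sub_eq_iff_eq_add, h2]
  have hz1 : ℓ (z 1) ≠ 0 := by
    have : z 1 = A (u 1) := by
      rw [hu]
      simp [z]
    rwa [this]
  -- Replacing `v` by `v - c • z` absorbs the variation of time and leaves the Volterra operator; `ℓ
  -- (z 1) ≠ 0` then determines `c`.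
  have key (v : C(I, E)) (c : ℝ) : v - T • L v - c • L u = (v - c • z) - T • L (v - c • z) := by
    rw [← hz, map_sub, map_smul, smul_sub, smul_sub, smul_comm T c]
    abel
  constructor
  · have hlin : IsLinearMap ℝ
        fun p : C(I, E) × ℝ => (p.1 - T • L p.1 - p.2 • L u, ℓ (p.1 1)) := by
      constructor
      · intro p q
        ext1
        · simp only [Prod.fst_add, Prod.snd_add, map_add, smul_add, add_smul]
          abel
        · simp
      · intro c p
        ext1
        · simp only [Prod.smul_fst, Prod.smul_snd, map_smul, smul_sub, smul_assoc, smul_comm T c]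
        · simp
    refine (injective_iff_map_eq_zero hlin.mk').2 ?_
    rintro ⟨v, c⟩ h
    simp only [IsLinearMap.mk'_apply, Prod.mk_eq_zero] at h
    rw [key, sub_eq_zero, hTL] at h
    have h0 := primitiveCLM_clm_injective _ h.1
    rw [sub_eq_zero] at h0
    have hc : c = 0 := by
      have := h.2
      rw [h0] at this
      simpa [hz1] using this
    simp [h0, hc]
  · rintro ⟨w, c⟩
    obtain ⟨v, hv⟩ := primitiveCLM_clm_surjective (T • A) w
    rw [← hTL] at hv
    refine ⟨(v + ((c - ℓ (v 1)) / ℓ (z 1)) • z, (c - ℓ (v 1)) / ℓ (z 1)), ?_⟩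
    ext1
    · simp only
      rw [key, add_sub_cancel_right, hv]
    · simp [hz1]

/-- Analytic dependence on `x` of the rescaled arcs `s ↦ x⁻¹ γ (τ s)`, `0 ≤ s ≤ 1`, of the solutions
`γ` of `γ' = F γ` starting at `x • e` and ending on the kernel of `ℓ`. -/
theorem exists_analytic_arc {F : E → E} {A : E →L[ℝ] E} {ℓ : E →L[ℝ] ℝ} {e : E} {T : ℝ} {y : ℝ → E}
    (hF : AnalyticAt ℝ F 0) (hF0 : F 0 = 0) (hFA : HasFDerivAt F A 0)
    (hy : ∀ s, HasDerivAt y (T • A (y s)) s) (hy0 : y 0 = e) (hy1 : ℓ (y 1) = 0)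
    (hℓ : ℓ (A (y 1)) ≠ 0) :
    ∃ (u w : ℝ → C(I, E)) (τ : ℝ → ℝ), AnalyticAt ℝ u 0 ∧ AnalyticAt ℝ τ 0 ∧ ContinuousAt w 0 ∧
      τ 0 = T ∧ (∀ s : I, u 0 s = y s) ∧ (∀ s : I, w 0 s = A (y s)) ∧
      ∀ᶠ x in 𝓝 0, u x = .const I e + τ x • primitiveCLM E (w x) ∧ ℓ (u x 1) = 0 ∧
        ∀ s, F (x • u x s) = x • w x s := by
  obtain ⟨M, hM, hMA, hFM⟩ := hF.exists_eventually_eq_clm_apply hF0 hFA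
  obtain ⟨N, hN, hNM⟩ := hM.exists_superposition I
  have hyc : Continuous y := continuous_iff_continuousAt.2 fun s => (hy s).continuousAt
  let u₀ : C(I, E) := ⟨fun s => y s, by fun_prop⟩
  -- Near `x = 0`, `W (x, u)` is `M (x u) u`: it extends `x⁻¹ F (x u)` analytically to `x = 0`, with
  -- value `A u`.
  let W : ℝ × C(I, E) → C(I, E) := fun p => ContinuousMap.applyCLM I E E (N (p.1 • p.2)) p.2
  have hN0 : N 0 = .const I A := by
    ext1 s
    rw [hNM.self_of_nhds s]
    simpa using hMA
  have hW0 (v : C(I, E)) : W (0, v) = ContinuousMap.applyCLM I E E (.const I A) v := by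
    simp [W, hN0]
  have hW : AnalyticAt ℝ W (0, u₀) := by
    have h1 : AnalyticAt ℝ (fun p : ℝ × C(I, E) => N (p.1 • p.2)) (0, u₀) := by
      refine AnalyticAt.fun_comp (g := N) ?_ (by fun_prop)
      simpa using hN
    exact ((ContinuousMap.applyCLM I E E).analyticAt_bilinear _).comp₂ h1 analyticAt_snd
  let Φ : ℝ × (C(I, E) × ℝ) → C(I, E) × ℝ := fun p =>
    (p.2.1 - .const I e - p.2.2 • primitiveCLM E (W (p.1, p.2.1)), ℓ (p.2.1 1))
  let L : C(I, E) →L[ℝ] C(I, E) :=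
    (primitiveCLM E).comp (ContinuousMap.applyCLM I E E (.const I A))
  have hΦ : AnalyticAt ℝ Φ (0, (u₀, T)) := by
    have hp₁ : AnalyticAt ℝ (fun p : ℝ × (C(I, E) × ℝ) => p.2.1) (0, (u₀, T)) :=
      analyticAt_fst.fun_comp analyticAt_snd
    have hp₂ : AnalyticAt ℝ (fun p : ℝ × (C(I, E) × ℝ) => p.2.2) (0, (u₀, T)) :=
      analyticAt_snd.fun_comp analyticAt_snd
    have h1 : AnalyticAt ℝ (fun p : ℝ × (C(I, E) × ℝ) => W (p.1, p.2.1)) (0, (u₀, T)) :=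
      AnalyticAt.fun_comp (g := W) (f := fun p : ℝ × (C(I, E) × ℝ) => (p.1, p.2.1)) hW
        (analyticAt_fst.prod hp₁)
    have h2 := ((primitiveCLM E).analyticAt (W (0, u₀))).fun_comp
      (f := fun p : ℝ × (C(I, E) × ℝ) => W (p.1, p.2.1)) (x := (0, (u₀, T))) h1
    have h3 : AnalyticAt ℝ (fun p : ℝ × (C(I, E) × ℝ) => ℓ (p.2.1 1)) (0, (u₀, T)) :=
      ((ℓ.comp (ContinuousMap.evalCLM ℝ (1 : I))).comp
        ((ContinuousLinearMap.fst ℝ C(I, E) ℝ).comp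
          (ContinuousLinearMap.snd ℝ ℝ (C(I, E) × ℝ)))).analyticAt _
    refine AnalyticAt.prod ?_ h3
    exact (hp₁.sub analyticAt_const).sub (hp₂.smul h2)
  have hu₀ : .const I e + T • L u₀ = u₀ := by
    have hd (s : I) : HasDerivAt y ((ContinuousMap.applyCLM I E E (.const I A) (T • u₀)) s) s := by
      simpa [u₀] using hy s
    have h := primitiveCLM_apply_eq_sub _ hd
    ext s
    rw [← map_smul]
    simp only [L, ContinuousLinearMap.comp_apply, ContinuousMap.add_apply, h]
    simp [u₀, hy0]
  have hΦ0 : Φ (0, (u₀, T)) = 0 := by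
    ext1
    · simp only [Φ, hW0]
      change u₀ - .const I e - T • L u₀ = 0
      rw [sub_sub, hu₀, sub_self]
    · simpa [Φ, u₀] using hy1
  have hbij := bijective_linearized_arc (A := A) (ℓ := ℓ) (T := T) (y := y) (u := u₀)
    (fun _ => rfl) hy (by simpa [u₀] using hℓ) (L := L) (fun _ => rfl)
  let D : C(I, E) × ℝ →L[ℝ] C(I, E) × ℝ :=
    ((ContinuousLinearMap.fst ℝ C(I, E) ℝ) - (T • L.comp (ContinuousLinearMap.fst ℝ C(I, E) ℝ) +
      (ContinuousLinearMap.snd ℝ C(I, E) ℝ).smulRight (L u₀))).prod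
      (ℓ.comp ((ContinuousMap.evalCLM ℝ (1 : I)).comp (ContinuousLinearMap.fst ℝ C(I, E) ℝ)))
  have hDbij : Function.Bijective D := by
    convert hbij using 1
    ext1 p
    ext1
    · simp [D, sub_sub]
    · simp [D]
  have hD : fderiv ℝ Φ (0, (u₀, T)) ∘L .inr ℝ ℝ (C(I, E) × ℝ) = D := by
    have h1 : HasFDerivAt (fun q : C(I, E) × ℝ => Φ (0, q))
        (fderiv ℝ Φ (0, (u₀, T)) ∘L .inr ℝ ℝ (C(I, E) × ℝ)) (u₀, T) :=
      HasFDerivAt.comp (g := Φ) (u₀, T) hΦ.differentiableAt.hasFDerivAt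
        (hasFDerivAt_prodMk_right (0 : ℝ) (u₀, T))
    have h2 : HasFDerivAt (fun q : C(I, E) × ℝ => Φ (0, q)) D (u₀, T) := by
      -- At `x = 0` the field is linear, so the partial derivative comes from an explicit formula,
      -- without differentiating `N`.
      have h3 : (fun q : C(I, E) × ℝ => Φ (0, q)) =
          fun q => (q.1 - .const I e - q.2 • L q.1, ℓ (q.1 1)) := by
        ext1 q
        simp only [Φ, hW0]
        rfl
      rw [h3]
      refine HasFDerivAt.prodMk ?_ ?_
      · refine (hasFDerivAt_fst.sub_const _).sub ?_
        exact hasFDerivAt_snd.smul (L.hasFDerivAt.comp (u₀, T) hasFDerivAt_fst)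
      · exact (ℓ.comp ((ContinuousMap.evalCLM ℝ (1 : I)).comp
          (ContinuousLinearMap.fst ℝ C(I, E) ℝ))).hasFDerivAt
    exact h1.unique h2
  have hinv : (fderiv ℝ Φ (0, (u₀, T)) ∘L .inr ℝ ℝ (C(I, E) × ℝ)).IsInvertible := by
    rw [hD]
    exact ⟨.ofBijective D (LinearMap.ker_eq_bot.2 hDbij.1) (LinearMap.range_eq_top.2 hDbij.2),
      ContinuousLinearEquiv.coe_ofBijective _ _ _⟩
  -- The top of `WithTop ℕ∞` is the analytic class, so the implicit function is analytic and not
  -- merely smooth.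
  have hne : (⊤ : WithTop ℕ∞) ≠ 0 := by simp
  have hc : ContDiffAt ℝ ⊤ Φ (0, (u₀, T)) := hΦ.contDiffAt
  have hψ := (hc.contDiffAt_implicitFunction hne hinv).analyticAt
  have hψ0 := hc.implicitFunction_apply_self hne hinv
  have hψe := hc.eventually_apply_implicitFunction hne hinv
  generalize hc.implicitFunction hne hinv = ψ at hψ hψ0 hψe
  simp only at hψ hψ0 hψe
  have hu : AnalyticAt ℝ (fun x => (ψ x).1) 0 := analyticAt_fst.fun_comp hψ
  refine ⟨fun x => (ψ x).1, fun x => W (x, (ψ x).1), fun x => (ψ x).2, hu,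
    analyticAt_snd.fun_comp hψ, ?_, congrArg Prod.snd hψ0,
    fun s => congrArg (fun q => q.1 s) hψ0, fun s => ?_, ?_⟩
  · refine ContinuousAt.comp (g := W) (f := fun x => (x, (ψ x).1)) ?_
      (continuousAt_id.prodMk hu.continuousAt)
    rw [hψ0]
    exact hW.continuousAt
  · simp only [hψ0, hW0]
    rfl
  · have hxu : Tendsto (fun x : ℝ => x • (ψ x).1) (𝓝 0) (𝓝 0) := by
      simpa using (continuousAt_id (x := (0 : ℝ))).tendsto.smul hu.continuousAt.tendsto
    obtain ⟨r, hr, hFr⟩ := Metric.eventually_nhds_iff.1 hFM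
    filter_upwards [hψe, hxu.eventually hNM, hxu.eventually (Metric.ball_mem_nhds _ hr)]
      with x hx hxN hxr
    rw [hΦ0] at hx
    refine ⟨?_, congrArg Prod.snd hx, fun s => ?_⟩
    · have := congrArg Prod.fst hx
      simp only [Φ, Prod.fst_zero, sub_sub] at this
      exact sub_eq_zero.1 this
    · rw [hFr, ← ContinuousMap.smul_apply, ← hxN s]
      · simp [W]
      · rw [dist_zero_right, ← ContinuousMap.smul_apply]
        exact (ContinuousMap.norm_coe_le_norm _ s).trans_lt (by simpa using hxr)

end Arc

/-! ### Uniqueness and positivity of arcs -/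

/-- Uniqueness of solutions of `g' = c f(g)` on `[0, 1]`, when only one of them is known to stay in
the open set where `f` is Lipschitz. -/
theorem eqOn_Icc_of_hasDerivWithinAt_smul {E : Type*} [NormedAddCommGroup E] [NormedSpace ℝ E]
    {f : E → E} {U : Set E} (hU : IsOpen U) {k : NNReal} (hf : LipschitzOnWith k f U) {c : ℝ}
    {g v : ℝ → E}
    (hg : ∀ s ∈ Icc (0 : ℝ) 1, HasDerivWithinAt g (c • f (g s)) (Icc 0 1) s)
    (hv : ∀ s ∈ Icc (0 : ℝ) 1, HasDerivWithinAt v (c • f (v s)) (Icc 0 1) s)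
    (hvU : ∀ s ∈ Icc (0 : ℝ) 1, v s ∈ U) (h0 : g 0 = v 0) : EqOn g v (Icc 0 1) := by
  have hgc : ContinuousOn g (Icc 0 1) := fun s hs => (hg s hs).continuousWithinAt
  have hvc : ContinuousOn v (Icc 0 1) := fun s hs => (hv s hs).continuousWithinAt
  have hclosed : IsClosed ({s | g s = v s} ∩ Icc 0 1) := by
    have := (hgc.sub hvc).preimage_isClosed_of_isClosed isClosed_Icc (isClosed_singleton (x := 0))
    convert this using 1
    ext s
    simp [sub_eq_zero, and_comm]
  -- Continuation: where `g` agrees with `v` it lies in the open set `U`, hence stays there a little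
  -- longer, and local uniqueness extends the agreement to the right.
  refine hclosed.Icc_subset_of_forall_exists_gt h0 ?_
  rintro s ⟨hs, hsI⟩ b hb
  have hI : Icc (0 : ℝ) 1 ∈ 𝓝[≥] s := Icc_mem_nhdsGE_of_mem hsI
  have hgU : g ⁻¹' U ∈ 𝓝[≥] s := by
    refine ((hgc s (Ico_subset_Icc_self hsI)).mono_of_mem_nhdsWithin hI) (hU.mem_nhds ?_)
    rw [show g s = v s from hs]
    exact hvU s (Ico_subset_Icc_self hsI)
  have hbs : Icc s b ∈ 𝓝[≥] s := Icc_mem_nhdsGE hb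
  obtain ⟨t, hst, ht⟩ := mem_nhdsGE_iff_exists_Icc_subset.1 (inter_mem (inter_mem hI hgU) hbs)
  have hst' : s < t := hst
  have htI := ht (right_mem_Icc.2 hst'.le)
  have hmem : ∀ r ∈ Ico s t, r ∈ Icc (0 : ℝ) 1 ∧ Icc (0 : ℝ) 1 ∈ 𝓝[≥] r := fun r hr =>
    ⟨(ht (Ico_subset_Icc_self hr)).1.1,
      Icc_mem_nhdsGE_of_mem ⟨(ht (Ico_subset_Icc_self hr)).1.1.1, hr.2.trans_le htI.1.1.2⟩⟩
  refine ⟨t, ?_, hst', htI.2.2⟩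
  exact ODE_solution_unique_of_mem_Icc_right (v := fun _ z => c • f z) (s := fun _ => U)
    (fun _ _ => (lipschitzWith_smul c).comp_lipschitzOnWith hf)
    (hgc.mono fun r hr => (ht hr).1.1)
    (fun r hr => (hg r (hmem r hr).1).mono_of_mem_nhdsWithin (hmem r hr).2)
    (fun r hr => (ht (Ico_subset_Icc_self hr)).1.2)
    (hvc.mono fun r hr => (ht hr).1.1)
    (fun r hr => (hv r (hmem r hr).1).mono_of_mem_nhdsWithin (hmem r hr).2)
    (fun r hr => hvU r (hmem r hr).1) hs (right_mem_Icc.2 hst'.le)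

/-- A function on `[0, 1]` vanishing at the end points is positive in between if it has no
nonpositive critical values. -/
theorem pos_of_forall_pos_or_deriv_ne_zero {y y' : ℝ → ℝ}
    (hy : ∀ s ∈ Icc (0 : ℝ) 1, HasDerivAt y (y' s) s) (h0 : y 0 = 0) (h1 : y 1 = 0)
    (h : ∀ s ∈ Icc (0 : ℝ) 1, 0 < y s ∨ y' s ≠ 0) : ∀ s ∈ Ioo (0 : ℝ) 1, 0 < y s := by
  have key : ∀ s ∈ Ioo (0 : ℝ) 1, IsMinOn y (Icc 0 1) s → 0 < y s := by
    intro s hs hmin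
    refine (h s (Ioo_subset_Icc_self hs)).resolve_right (not_not.2 ?_)
    exact (hmin.isLocalMin (Icc_mem_nhds hs.1 hs.2)).hasDerivAt_eq_zero
      (hy s (Ioo_subset_Icc_self hs))
  obtain ⟨m, hm, hmin⟩ := isCompact_Icc.exists_isMinOn (nonempty_Icc.2 (zero_le_one (α := ℝ)))
    (fun s hs => (hy s hs).continuousAt.continuousWithinAt)
  intro s hs
  have hms := hmin (Ioo_subset_Icc_self hs)
  by_cases hmI : m ∈ Ioo (0 : ℝ) 1
  · exact (key m hmI hmin).trans_le hms
  · have hm0 : y m = 0 := by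
      rcases hm.1.eq_or_lt with h | h
      · rwa [← h]
      · rcases hm.2.eq_or_lt with h' | h'
        · rwa [h']
        · exact absurd ⟨h, h'⟩ hmI
    -- The minimum is `0`, attained at an end point; a nonpositive value at `s` would make `s` an
    -- interior minimum, against `key`.
    by_contra! hneg
    have hs0 : y s = y m := le_antisymm (hneg.trans hm0.ge) hms
    refine (key s hs fun r hr => ?_).not_ge hneg
    change y s ≤ y r
    rw [hs0]
    exact hmin hr

/-! ### Rescaling of time and uniqueness of the upper arc -/

theorem div_mem_Icc_of_mem_uIcc {s t : ℝ} (hs : s ∈ uIcc 0 t) : s / t ∈ Icc (0 : ℝ) 1 := by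
  rcases le_total 0 t with h | h
  · rw [uIcc_of_le h] at hs
    exact ⟨div_nonneg hs.1 h, div_le_one_of_le₀ hs.2 h⟩
  · rw [uIcc_of_ge h] at hs
    exact ⟨div_nonneg_of_nonpos hs.2 h, div_le_one_of_ge hs.1 h⟩

theorem div_mem_Ioo_of_mem_Ioo {s t : ℝ} (hs : s ∈ Ioo (min 0 t) (max 0 t)) :
    s / t ∈ Ioo (0 : ℝ) 1 := by
  rcases lt_trichotomy 0 t with h | h | h
  · rw [min_eq_left h.le, max_eq_right h.le] at hs
    exact ⟨div_pos hs.1 h, (div_lt_one h).2 hs.2⟩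
  · simp [← h] at hs
  · rw [min_eq_right h.le, max_eq_left h.le] at hs
    exact ⟨div_pos_of_neg_of_neg hs.2 h, (div_lt_one_of_neg h).2 hs.1⟩

theorem mul_mem_uIcc_of_mem_Icc {r : ℝ} (t : ℝ) (hr : r ∈ Icc (0 : ℝ) 1) : t * r ∈ uIcc 0 t := by
  rcases le_total 0 t with h | h
  · rw [uIcc_of_le h]
    exact ⟨mul_nonneg h hr.1, mul_le_of_le_one_right h hr.2⟩
  · rw [uIcc_of_ge h]
    exact ⟨by nlinarith [hr.2], mul_nonpos_of_nonpos_of_nonneg h hr.1⟩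

theorem mul_mem_Ioo_of_mem_Ioo {r t : ℝ} (ht : t ≠ 0) (hr : r ∈ Ioo (0 : ℝ) 1) :
    t * r ∈ Ioo (min 0 t) (max 0 t) := by
  rcases ht.lt_or_gt with h | h
  · rw [min_eq_right h.le, max_eq_left h.le]
    exact ⟨by nlinarith [hr.2], mul_neg_of_neg_of_pos h hr.1⟩
  · rw [min_eq_left h.le, max_eq_right h.le]
    exact ⟨mul_pos h hr.1, mul_lt_of_lt_one_right h hr.2⟩

/-- An upper arc, rescaled to the time interval `[0, 1]`, that stays in an open set where the field
is Lipschitz is the only upper arc from its starting point. -/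
theorem upperArc_iff {Z : ℝ × ℝ → ℝ × ℝ} {U : Set (ℝ × ℝ)} (hU : IsOpen U) {k : NNReal}
    (hZ : LipschitzOnWith k Z U) {x τ : ℝ} {v : ℝ → ℝ × ℝ} (hv0 : v 0 = (x, 0))
    (hv : ∀ s ∈ Icc (0 : ℝ) 1, HasDerivAt v (τ • Z (v s)) s)
    (hvU : ∀ s ∈ Icc (0 : ℝ) 1, v s ∈ U) (hv1 : (v 1).2 = 0)
    (hpos : ∀ s ∈ Ioo (0 : ℝ) 1, 0 < (v s).2) (hτ : 0 < τ * (Z (x, 0)).2) (t ξ : ℝ) :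
    UpperArc Z x t ξ ↔ t = τ ∧ ξ = (v 1).1 := by
  have hτ0 : τ ≠ 0 := by
    rintro rfl
    simp at hτ
  constructor
  · rintro ⟨ht, γ, hγ0, hγt, hγ, hγpos⟩
    have hscale : ∀ r ∈ Icc (0 : ℝ) 1,
        HasDerivWithinAt (fun r => γ (t * r)) (t • Z (γ (t * r))) (Icc 0 1) r := by
      intro r hr
      refine (hγ _ (mul_mem_uIcc_of_mem_Icc t hr)).scomp r
        (h := fun r => t * r) (h' := t) ?_ (fun r hr => mul_mem_uIcc_of_mem_Icc t hr)
      simpa using ((hasDerivAt_id r).const_mul t).hasDerivWithinAt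
    -- Both arcs run in the same direction of time: since `γ` ends on the axis and is above it in
    -- between, the initial slope `t * (Z (x, 0)).2` of its rescaled height is nonnegative.
    have hsame : 0 < t * τ := by
      by_contra! hneg
      have hlt : t * (Z (x, 0)).2 < 0 := by
        have h1 : t * τ < 0 := lt_of_le_of_ne hneg (mul_ne_zero ht hτ0)
        by_contra! h2
        have h3 := mul_pos_of_neg_of_neg h1 (neg_neg_of_pos hτ)
        have h4 := mul_nonneg (mul_self_nonneg τ) h2
        nlinarith
      have h0 := hscale 0 (by simp)
      have h1 : HasDerivWithinAt (fun r => (γ (t * r)).2) (t * (Z (x, 0)).2) (Icc 0 1) 0 := by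
        have h := h0.snd
        rwa [mul_zero, hγ0] at h
      rw [hasDerivWithinAt_iff_tendsto_slope] at h1
      have hne : (𝓝[Icc (0 : ℝ) 1 \ {0}] 0).NeBot := by
        rw [Icc_sdiff_left, nhdsWithin_Ioc_eq_nhdsGT zero_lt_one]
        infer_instance
      refine hlt.not_ge (ge_of_tendsto h1 ?_)
      filter_upwards [self_mem_nhdsWithin] with r hr
      have hr0 : 0 < r := lt_of_le_of_ne hr.1.1 (Ne.symm hr.2)
      have : 0 ≤ (γ (t * r)).2 := by
        rcases hr.1.2.lt_or_eq with h | h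
        · exact (hγpos _ (mul_mem_Ioo_of_mem_Ioo ht ⟨hr0, h⟩)).le
        · simp [h, hγt]
      simp only [slope_def_field, mul_zero, hγ0, sub_zero]
      positivity
    have hρ : 0 < t / τ := by
      rw [div_eq_mul_inv, ← mul_pos_iff_of_pos_right (mul_self_pos.2 hτ0)]
      field_simp
      linarith
    -- The arc that ends sooner coincides with the initial piece of the other, so its end on the
    -- axis would be an interior point of the other unless `t = τ`.
    rcases le_or_gt (t / τ) 1 with hle | hgt
    · have hsub : ∀ r ∈ Icc (0 : ℝ) 1, t / τ * r ∈ Icc (0 : ℝ) 1 := fun r hr =>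
        ⟨mul_nonneg hρ.le hr.1, mul_le_one₀ hle hr.1 hr.2⟩
      have heq := eqOn_Icc_of_hasDerivWithinAt_smul hU hZ hscale
        (v := fun r => v (t / τ * r)) (fun r hr => by
          have h := (hv _ (hsub r hr)).scomp r
            (h := fun r => t / τ * r) (h' := t / τ) (by
              simpa using (hasDerivAt_id r).const_mul (t / τ))
          rw [smul_smul, div_mul_cancel₀ _ hτ0] at h
          exact h.hasDerivWithinAt)
        (fun r hr => hvU _ (hsub r hr)) (by simp [hγ0, hv0])
      have h1 := heq (right_mem_Icc.2 zero_le_one)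
      simp only [mul_one, hγt] at h1
      rcases hle.eq_or_lt with h | h
      · rw [h] at h1
        exact ⟨(div_eq_one_iff_eq hτ0).1 h, by rw [← h1]⟩
      · have := hpos _ ⟨hρ, h⟩
        simp [← h1] at this
    · have hρ' : (t / τ)⁻¹ ∈ Ioo (0 : ℝ) 1 := ⟨inv_pos.2 hρ, inv_lt_one_of_one_lt₀ hgt⟩
      have hsub : ∀ r ∈ Icc (0 : ℝ) 1, (t / τ)⁻¹ * r ∈ Icc (0 : ℝ) 1 := fun r hr =>
        ⟨mul_nonneg hρ'.1.le hr.1, mul_le_one₀ hρ'.2.le hr.1 hr.2⟩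
      have heq := eqOn_Icc_of_hasDerivWithinAt_smul hU hZ (c := τ)
        (g := fun r => γ (t * ((t / τ)⁻¹ * r))) (v := v) (fun r hr => by
          have h := (hscale _ (hsub r hr)).scomp r
            (h := fun r => (t / τ)⁻¹ * r) (h' := (t / τ)⁻¹) (t' := Icc 0 1) (by
              simpa using ((hasDerivAt_id r).const_mul (t / τ)⁻¹).hasDerivWithinAt) hsub
          rw [smul_smul, inv_div, div_mul_cancel₀ _ ht, ← inv_div t τ] at h
          exact h)
        (fun r hr => (hv r hr).hasDerivWithinAt) hvU (by simp [hγ0, hv0])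
      have h1 := heq (right_mem_Icc.2 zero_le_one)
      simp only [mul_one] at h1
      have := hγpos _ (mul_mem_Ioo_of_mem_Ioo ht hρ')
      rw [h1, hv1] at this
      exact absurd this (lt_irrefl _)
  · rintro ⟨rfl, rfl⟩
    refine ⟨hτ0, fun s => v (s / t), by simpa using hv0, ?_, fun s hs => ?_, fun s hs => ?_⟩
    · simp only [div_self hτ0]
      exact Prod.ext rfl hv1
    · have h := (hv _ (div_mem_Icc_of_mem_uIcc hs)).scomp s
        (h := fun s => s / t) (h' := 1 / t) ((hasDerivAt_id s).div_const t)
      rw [smul_smul, one_div, inv_mul_cancel₀ hτ0, one_smul] at h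
      exact h.hasDerivWithinAt
    · exact hpos _ (div_mem_Ioo_of_mem_Ioo hs)

/-! ### Power series and the linear part of the field -/

theorem AnalyticAt.exists_eventually_hasSum {f : ℝ → ℝ} (hf : AnalyticAt ℝ f 0) :
    ∃ c : ℕ → ℝ, c 0 = f 0 ∧ ∀ᶠ x in 𝓝 0, HasSum (fun i => c i * x ^ i) (f x) := by
  obtain ⟨p, hp⟩ := hf
  refine ⟨p.coeff, hp.coeff_zero _, ?_⟩
  filter_upwards [hp.eventually_hasSum] with x hx
  simpa [mul_comm] using hx

/-- The linear part of the field. -/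
noncomputable def planarLinear (a b c d : ℝ) : ℝ × ℝ →L[ℝ] ℝ × ℝ :=
  (a • ContinuousLinearMap.fst ℝ ℝ ℝ + b • ContinuousLinearMap.snd ℝ ℝ ℝ).prod
    (c • ContinuousLinearMap.fst ℝ ℝ ℝ + d • ContinuousLinearMap.snd ℝ ℝ ℝ)

theorem planarLinear_apply (a b c d : ℝ) (z : ℝ × ℝ) :
    planarLinear a b c d z = (a * z.1 + b * z.2, c * z.1 + d * z.2) := by
  simp [planarLinear]

theorem IsElementaryMonodromic.exists_planarField {P Q : ℝ × ℝ → ℝ} {a b c d : ℝ}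
    (h : IsElementaryMonodromic P Q a b c d) :
    AnalyticAt ℝ (planarField P Q) 0 ∧ planarField P Q 0 = 0 ∧
      HasFDerivAt (planarField P Q) (planarLinear a b c d) 0 := by
  obtain ⟨P₂, hPa, hP0, hPd, hP⟩ := h.exists_P
  obtain ⟨Q₂, hQa, hQ0, hQd, hQ⟩ := h.exists_Q
  have heq : planarField P Q = fun z => planarLinear a b c d z + (P₂ z, Q₂ z) := by
    ext1 z
    obtain ⟨x, y⟩ := z
    simp [planarField, planarLinear_apply, hP, hQ]
  rw [heq]
  refine ⟨((planarLinear a b c d).analyticAt 0).add (hPa.prod hQa), ?_, ?_⟩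
  · rw [Prod.mk_zero_zero] at hP0 hQ0
    simp [hP0, hQ0]
  · have := (planarLinear a b c d).hasFDerivAt (x := (0 : ℝ × ℝ)) |>.add (hPd.prodMk hQd)
    refine this.congr_fderiv ?_
    ext <;> simp

/-- The orbit of `(1, 0)` under the flow of the linear part, with time rescaled by `T`. -/
noncomputable def linearArc (a c d ω T : ℝ) (s : ℝ) : ℝ × ℝ :=
  (Real.exp ((a + d) / 2 * T * s) *
      (Real.cos (ω * T * s) + (a - d) / 2 * (Real.sin (ω * T * s) / ω)),
    Real.exp ((a + d) / 2 * T * s) * (c * (Real.sin (ω * T * s) / ω)))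

/-- The traceless part `N` of the matrix satisfies `N ^ 2 = -ω ^ 2`, so its exponential is `cos (ω
t) + N sin (ω t) / ω`. The arc is the first column, times the trace factor. -/
theorem hasDerivAt_linearArc {a b c d ω : ℝ} (hω : ω ≠ 0)
    (h : ((a - d) / 2) ^ 2 + b * c = -ω ^ 2) (T s : ℝ) :
    HasDerivAt (linearArc a c d ω T) (T • planarLinear a b c d (linearArc a c d ω T s)) s := by
  have hlin (k : ℝ) : HasDerivAt (fun s : ℝ => k * s) k s := by
    simpa using (hasDerivAt_id s).const_mul k
  have he := (hlin ((a + d) / 2 * T)).exp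
  have hc := (hlin (ω * T)).cos
  have hs := ((hlin (ω * T)).sin.div_const ω)
  have h1 := he.mul (hc.add (hs.const_mul ((a - d) / 2)))
  have h2 := he.mul (hs.const_mul c)
  refine (h1.prodMk h2).congr_deriv ?_
  have hbc : b * c = -ω ^ 2 - ((a - d) / 2) ^ 2 := by linarith
  simp only [planarLinear_apply, linearArc, Pi.add_apply]
  generalize Real.sin (ω * T * s) = S
  generalize Real.cos (ω * T * s) = C
  generalize Real.exp ((a + d) / 2 * T * s) = e
  ext1
  · simp only [Prod.smul_fst, smul_eq_mul]
    field_simp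
    linear_combination (-4 * e * T * S) * hbc
  · simp only [Prod.smul_snd, smul_eq_mul]
    field_simp
    ring

/-! ### The half-return map -/

theorem mainTheorem8 (P Q : ℝ × ℝ → ℝ) (a₁₀ a₀₁ b₁₀ b₀₁ : ℝ)
    (hZ : IsElementaryMonodromic P Q a₁₀ a₀₁ b₁₀ b₀₁) :
    ∃ (x₀ : ℝ) (φ τ : ℝ → ℝ), IsHalfReturn (planarField P Q) x₀ φ τ ∧
      AnalyticOnNhd ℝ φ (Ioo (-x₀) x₀) ∧ AnalyticOnNhd ℝ τ (Ioo (-x₀) x₀) ∧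
      ∃ α T : ℕ → ℝ,
        (∀ x ∈ Ioo (-x₀) x₀, HasSum (fun i : ℕ => -(α (i + 1) * x ^ (i + 1))) (φ x)) ∧
        (∀ x ∈ Ioo (-x₀) x₀, HasSum (fun i : ℕ => T i * x ^ i) (τ x)) ∧
        α 1 = Real.exp ((SignType.sign b₁₀ : ℝ) * (Real.pi * (a₁₀ + b₀₁) /
          Real.sqrt (-4 * b₁₀ * a₀₁ - (a₁₀ - b₀₁) ^ 2))) ∧
        0 < b₁₀ * T 0 := by
  obtain ⟨hF, hF0, hFA⟩ := hZ.exists_planarField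
  have hdisc := hZ.disc_neg
  set F := planarField P Q
  have hb : b₁₀ ≠ 0 := by
    rintro rfl
    nlinarith [sq_nonneg (a₁₀ - b₀₁)]
  set R := Real.sqrt (-4 * b₁₀ * a₀₁ - (a₁₀ - b₀₁) ^ 2)
  have hRpos : 0 < R := Real.sqrt_pos.2 (by linarith)
  have hRsq : R ^ 2 = -4 * b₁₀ * a₀₁ - (a₁₀ - b₀₁) ^ 2 := Real.sq_sqrt (by linarith)
  set ε : ℝ := (SignType.sign b₁₀ : ℝ) with hε
  have hεb : 0 < b₁₀ * ε := by
    rw [hε, mul_comm, sign_mul_self]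
    exact abs_pos.2 hb
  have hε1 : ε = 1 ∨ ε = -1 := by
    rcases hb.lt_or_gt with h | h
    · exact .inr (by simp [hε, sign_neg h])
    · exact .inl (by simp [hε, sign_pos h])
  set ω := R / 2 with hω
  have hωpos : 0 < ω := by positivity
  -- Half a turn at angular frequency `ω`, in the direction of time that makes the height, a
  -- positive multiple of `b₁₀ * sin (ω * T₀ * s)`, positive.
  set T₀ := ε * Real.pi / ω with hT₀
  have hωT : ω * T₀ = ε * Real.pi := by rw [hT₀]; field_simp
  have hcT : 0 < b₁₀ * T₀ := by
    rw [hT₀, mul_div_assoc', ← mul_assoc]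
    have := Real.pi_pos
    positivity
  have hy := fun s => hasDerivAt_linearArc (a := a₁₀) (b := a₀₁) (c := b₁₀) (d := b₀₁) hωpos.ne'
    (by rw [hω, div_pow R, hRsq]; ring) T₀ s
  have hy0 : linearArc a₁₀ b₁₀ b₀₁ ω T₀ 0 = (1, 0) := by simp [linearArc]
  have hy1 : linearArc a₁₀ b₁₀ b₀₁ ω T₀ 1 = (-Real.exp ((a₁₀ + b₀₁) / 2 * T₀), 0) := by
    rcases hε1 with h | h <;> simp [linearArc, hωT, h]
  have hypos : ∀ s ∈ Ioo (0 : ℝ) 1, 0 < (linearArc a₁₀ b₁₀ b₀₁ ω T₀ s).2 := by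
    intro s hs
    have hsin : 0 < Real.sin (Real.pi * s) := Real.sin_pos_of_pos_of_lt_pi
      (mul_pos Real.pi_pos hs.1) (mul_lt_of_lt_one_right Real.pi_pos hs.2)
    have h1 : b₁₀ * (Real.sin (ω * T₀ * s) / ω) = b₁₀ * ε * Real.sin (Real.pi * s) / ω := by
      rcases hε1 with h | h <;> simp [hωT, h, mul_div_assoc, neg_div]
    simp only [linearArc, h1]
    positivity
  obtain ⟨u, w, τ, hu, hτ, hw, hτ0, hu0, hw0, hev⟩ := exists_analytic_arc
    (ℓ := ContinuousLinearMap.snd ℝ ℝ ℝ) hF hF0 hFA hy hy0 (by simp [hy1])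
    (by simp [hy1, planarLinear_apply, hb])
  -- Positivity of the height is not stable at the end points, where it vanishes. "Positive or with
  -- nonzero derivative" is an open condition, true at `x = 0` by transversality, and it persists by
  -- compactness of `[0, 1]`.
  have hgood : ∀ᶠ x in 𝓝 (0 : ℝ), ∀ s ∈ (univ : Set unitInterval),
      0 < (u x s).2 ∨ τ x * (w x s).2 ≠ 0 := by
    refine isCompact_univ.eventually_forall_of_forall_eventually fun s _ => ?_
    have hcu : ContinuousAt (fun z : ℝ × unitInterval => (u z.1 z.2).2) (0, s) :=
      ((hu.continuousAt.comp (x := ((0 : ℝ), s)) continuousAt_fst).eval continuousAt_snd).snd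
    have hcw : ContinuousAt (fun z : ℝ × unitInterval => τ z.1 * (w z.1 z.2).2) (0, s) :=
      (hτ.continuousAt.comp (x := ((0 : ℝ), s)) continuousAt_fst).mul
        ((ContinuousAt.comp (x := ((0 : ℝ), s)) hw continuousAt_fst).eval continuousAt_snd).snd
    by_cases hs : (s : ℝ) ∈ Ioo (0 : ℝ) 1
    · have h0 : 0 < (u 0 s).2 := by
        rw [hu0]
        exact hypos _ hs
      filter_upwards [hcu.eventually_const_lt h0] with z hz using .inl hz
    · have h0 : τ 0 * (w 0 s).2 ≠ 0 := by
        have hT : T₀ ≠ 0 := by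
          rintro h
          simp [h] at hcT
        rw [hw0, hτ0]
        rcases s.2.1.eq_or_lt with h | h
        · rw [← h, hy0]
          simp [planarLinear_apply, hT, hb]
        · have h' : (s : ℝ) = 1 := by
            by_contra hne
            exact hs ⟨h, lt_of_le_of_ne s.2.2 hne⟩
          rw [h', hy1]
          simp [planarLinear_apply, hT, hb]
      filter_upwards [hcw.eventually_ne h0] with z hz using .inr hz
  obtain ⟨k, U, hU, hLip⟩ := (hF.contDiffAt (n := 1)).exists_lipschitzOnWith
  obtain ⟨r, hr, hrU⟩ := Metric.mem_nhds_iff.1 hU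
  have hball : ∀ᶠ x in 𝓝 (0 : ℝ), x • u x ∈ Metric.ball (0 : C(unitInterval, ℝ × ℝ)) r := by
    have : Tendsto (fun x : ℝ => x • u x) (𝓝 0) (𝓝 0) := by
      simpa using (continuousAt_id (x := (0 : ℝ))).tendsto.smul hu.continuousAt.tendsto
    exact this.eventually (Metric.ball_mem_nhds _ hr)
  have htrans : ∀ᶠ x in 𝓝 (0 : ℝ), 0 < τ x * (w x 0).2 := by
    have hc : ContinuousAt (fun x => τ x * (w x 0).2) 0 :=
      hτ.continuousAt.mul (hw.eval continuousAt_const).snd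
    refine hc.eventually_const_lt ?_
    change 0 < τ 0 * (w 0 0).2
    rw [hτ0, hw0, Icc.coe_zero, hy0]
    simpa [planarLinear_apply, mul_comm] using hcT
  set ψ : ℝ → ℝ := fun x => (u x 1).1 with hψdef
  have hψ : AnalyticAt ℝ ψ 0 :=
    (((ContinuousLinearMap.fst ℝ ℝ ℝ).comp
      (ContinuousMap.evalCLM ℝ (1 : unitInterval))).analyticAt (u 0)).fun_comp hu
  have hψ0 : ψ 0 = -Real.exp ((a₁₀ + b₀₁) / 2 * T₀) := by
    simp [hψdef, hu0, hy1]
  have hψneg : ∀ᶠ x in 𝓝 (0 : ℝ), ψ x < 0 :=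
    hψ.continuousAt.eventually_lt_const (by rw [hψ0]; simp [Real.exp_pos])
  obtain ⟨cψ, hcψ0, hcψ⟩ := hψ.exists_eventually_hasSum
  obtain ⟨cτ, hcτ0, hcτ⟩ := hτ.exists_eventually_hasSum
  obtain ⟨x₀, hx₀, hall⟩ := Metric.eventually_nhds_iff_ball.1
    (hev.and (hgood.and (hball.and (htrans.and (hψneg.and (hcψ.and (hcτ.and
      (hψ.eventually_analyticAt.and hτ.eventually_analyticAt))))))))
  rw [Real.ball_eq_Ioo, zero_sub, zero_add] at hall
  have hφa : AnalyticOnNhd ℝ (fun x => x * ψ x) (Ioo (-x₀) x₀) := fun x hx =>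
    analyticAt_id.mul (hall x hx).2.2.2.2.2.2.2.1
  have hτa : AnalyticOnNhd ℝ τ (Ioo (-x₀) x₀) := fun x hx => (hall x hx).2.2.2.2.2.2.2.2
  have hsub : Ico 0 x₀ ⊆ Ioo (-x₀) x₀ := fun x hx => ⟨by linarith [hx.1], hx.2⟩
  refine ⟨x₀, fun x => x * ψ x, τ, ⟨hx₀, ?_, ?_, by simp, hφa.continuousOn.mono hsub,
    hτa.continuousOn.mono (Ioo_subset_Ico_self.trans hsub)⟩, hφa, hτa,
    -- As `φ x = x * ψ x`, the coefficients of `ψ` move up by one degree. The truncated subtraction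
    -- at `i = 0` gives a value that no claim uses.
    fun i => -cψ (i - 1), cτ, ?_, ?_, ?_, ?_⟩
  · intro x hx t ξ
    obtain ⟨⟨hxu, hx1, hxF⟩, hxg, hxr, hxt, -⟩ := hall x (hsub (Ioo_subset_Ico_self hx))
    -- The integral formula extends the arc `u x` to the whole line, which gives two-sided
    -- derivatives at `0` and `1`.
    let V : ℝ → ℝ × ℝ := fun s => (1, 0) + τ x • ∫ r in (0 : ℝ)..s, (w x).extendUnit r
    have hV (s : unitInterval) : V s = u x s := by
      conv_rhs => rw [hxu]
      rfl
    have hVd (s : unitInterval) : HasDerivAt V (τ x • w x s) s := by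
      have := ((w x).hasDerivAt_integral_extendUnit s).const_smul (τ x) |>.const_add (1, 0)
      rwa [(w x).extendUnit_coe] at this
    have hV0 : V 0 = (1, 0) := by simp [V]
    have hV1 : (V 1).2 = 0 := by
      rw [← Icc.coe_one, hV]
      exact hx1
    have hVpos := pos_of_forall_pos_or_deriv_ne_zero (y := fun s => (V s).2)
      (y' := fun s => τ x * ((w x).extendUnit s).2)
      (fun s hs => by
        have h1 := (hVd ⟨s, hs⟩).snd
        rwa [← (w x).extendUnit_coe] at h1)
      (by simp [hV0]) hV1
      (fun s hs => by
        have h1 := hxg ⟨s, hs⟩ trivial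
        rwa [← hV, ← (w x).extendUnit_coe] at h1)
    have hF1 : F (x, 0) = x • w x 0 := by
      rw [← hxF, ← hV, Icc.coe_zero, hV0]
      simp
    have key := upperArc_iff (Z := F) (U := Metric.ball 0 r) Metric.isOpen_ball (hLip.mono hrU)
      (x := x) (τ := τ x) (v := fun s => x • V s) (by simp [hV0])
      (fun s hs => by
        have h1 := (hVd ⟨s, hs⟩).const_smul x
        rw [smul_comm, ← hxF, ← hV] at h1
        exact h1)
      (fun s hs => by
        have h1 := hV ⟨s, hs⟩
        simp only at h1
        rw [h1, mem_ball_zero_iff, ← ContinuousMap.smul_apply]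
        exact (ContinuousMap.norm_coe_le_norm _ _).trans_lt (mem_ball_zero_iff.1 hxr))
      (by simp [hV1]) (fun s hs => by simpa [hx.1] using hVpos s hs)
      (by
        rw [hF1, Prod.smul_snd, smul_eq_mul, mul_left_comm]
        exact mul_pos hx.1 hxt) t ξ
    have hψx : ψ x = (V 1).1 := by
      have := hV 1
      rw [Icc.coe_one] at this
      rw [this]
    rw [key, hψx]
    rfl
  · intro x hx
    exact mul_neg_of_pos_of_neg hx.1 (hall x (hsub (Ioo_subset_Ico_self hx))).2.2.2.2.1
  · intro x hx
    have h := (hall x hx).2.2.2.2.2.1.mul_left x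
    refine h.congr_fun fun i => ?_
    simp only [add_tsub_cancel_right]
    ring
  · exact fun x hx => (hall x hx).2.2.2.2.2.2.1
  · simp only [tsub_self, hcψ0, hψ0, neg_neg]
    congr 1
    rw [hT₀, hω]
    field_simp
  · rwa [hcτ0, hτ0]
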